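/- Notation. For a finite set $N$ let $\mathbb{R}^N$ be the space of functions $N\to\mathbb{R}$. A function $\phi\colon N\to M$ of finite sets induces the pullback $\phi^*\colon\mathbb{R}^M\to\mathbb{R}^N$, $\phi^*(y)_i=y_{\phi(i)}$, and the pushforward $\phi_*\colon\mathbb{R}^N\to\mathbb{R}^M$, $\phi_*(x)_j=\sum_{i\in\phi^{-1}(j)}x_i$. Let $[2]=\{1,2\}$, where the label $1$ means convex and $2$ means concave, and let $U\colon\mathbf{FinSet}/[2]\to\mathbf{FinSet}$ be the forgetful functor; both categories carry the monoidal structure given by disjoint union (labelled by the copairing), and $\mathbf{Set}$ carries the Cartesian one. For $\tau\colon N\to[2]$ put $N_k=\tau^{-1}(k)$ and identify $\mathbb{R}^N=\mathbb{R}^{N_1}\times\mathbb{R}^{N_2}$, writing $x=(x_1,x_2)$. The lax symmetric monoidal functor $\mathsf{Saddle}\colon(\mathbf{FinSet}/[2],+)\to(\mathbf{Set},\times)$ sends $\tau\colon N\to[2]$ to the set of functions $f\colon\mathbb{R}^N\to\mathbb{R}$ such that $f(\cdot,x_2)$ is convex for every $x_2\in\mathbb{R}^{N_2}$ and $f(x_1,\cdot)$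 is concave for every $x_1\in\mathbb{R}^{N_1}$ (no differentiability is assumed), and sends a label-preserving function $\phi$ to $f\mapsto f\circ\phi^*$; its product comparison is $(f,g)\mapsto f\circ\iota_N^*+g\circ\iota_M^*$, where $\iota_N,\iota_M$ are the inclusions of $N$ and $M$ into $N+M$, and its unit comparison picks the zero function. The lax symmetric monoidal functor $\mathsf{NDD}\colon(\mathbf{FinSet},+)\to(\mathbf{Set},\times)$ sends $N$ to the set of functions $v\colon\mathbb{R}^N\to\mathcal{P}(\mathbb{R}^N)$ and $\phi\colon N\to M$ to $v\mapsto\bigl(z\mapsto\phi_*\bigl[v(\phi^*z)\bigr]\bigr)$ (direct image); its product comparison sends $(v,w)$ to $z\mapsto\iota_{N*}[v(\iota_N^*z)]+\iota_{M*}[w(\iota_M^*z)]$ (Minkowski sum), and its unit comparison picks $0\mapsto\{0\}$. Theorem. There is a monoidal natural transformation $\mathsf{pd\text{-}subg}\colon\mathsf{Saddle}\Rightarrow\mathsf{NDD}\circ U$ whose component at $\tau\colon N\to[2]$ is given, for every $f\in\mathsf{Saddle}(\tau)$ and $x=(x_1,x_2)\in\mathbb{R}^N$, by $$\mathsf{pd\text{-}subg}_\tau(f)(x)=\bigl\{(-p,q)\;:\;p\in\partial_1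 f(x),\ q\in\partial_2 f(x)\bigr\}\subseteq\mathbb{R}^{N_1}\times\mathbb{R}^{N_2}=\mathbb{R}^N,$$ where $$\partial_1 f(x)=\{p\in\mathbb{R}^{N_1} : f(y,x_2)-f(x_1,x_2)\ge p^{T}(y-x_1)\ \text{for all } y\in\mathbb{R}^{N_1}\}$$ is the subdifferential of the convex function $f(\cdot,x_2)$ at $x_1$ and $$\partial_2 f(x)=\{q\in\mathbb{R}^{N_2} : f(x_1,y)-f(x_1,x_2)\le q^{T}(y-x_2)\ \text{for all } y\in\mathbb{R}^{N_2}\}$$ is the superdifferential of the concave function $f(x_1,\cdot)$ at $x_2$. Thus an update direction $v$ has coordinates $v_i=-p_i$ at the convex-labelled $i$ and $v_i=q_i$ at the concave-labelled $i$. -/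

import Mathlib

open CategoryTheory MonoidalCategory
open scoped Pointwise

namespace PDSubg

/-! ### Pushforwards and pullbacks between the free vector spaces `ℝ^N = (N → ℝ)` -/

section PushPull

variable {N M K : Type}

/-- The pullback `φ^* : ℝ^M → ℝ^N`, `(φ^* y)_i = y_{φ i}`. -/
def pull (φ : N → M) : (M → ℝ) →ₗ[ℝ] (N → ℝ) := LinearMap.funLeft ℝ ℝ φ

@[simp] theorem pull_apply (φ : N → M) (y : M → ℝ) (i : N) : pull φ y i = y (φ i) := rfl

/-- The pushforward `φ_* : ℝ^N → ℝ^M`, `(φ_* x)_j = ∑_{i ∈ φ⁻¹(j)} x_i`. -/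
noncomputable def push [Finite N] (φ : N → M) : (N → ℝ) →ₗ[ℝ] (M → ℝ) where
  toFun x j := ∑ᶠ i ∈ φ ⁻¹' {j}, x i
  map_add' x y := by
    funext j
    exact finsum_mem_add_distrib (Set.toFinite _)
  map_smul' c x := by
    funext j
    simp only [Pi.smul_apply, RingHom.id_apply, smul_eq_mul]
    exact (mul_finsum_mem x c).symm

theorem push_apply [Finite N] (φ : N → M) (x : N → ℝ) (j : M) :
    push φ x j = ∑ᶠ i ∈ φ ⁻¹' {j}, x i := rfl

theorem push_id [Finite N] (x : N → ℝ) : push (fun i : N => i) x = x := by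
  funext j
  rw [push_apply]
  have : (fun i : N => i) ⁻¹' {j} = {j} := rfl
  rw [this, finsum_mem_singleton]

theorem push_push [Finite N] [Finite M] (φ : N → M) (ψ : M → K) (x : N → ℝ) :
    push ψ (push φ x) = push (fun i => ψ (φ i)) x := by
  funext k
  simp only [push_apply]
  have h : (fun i => ψ (φ i)) ⁻¹' {k} = ⋃ j ∈ ψ ⁻¹' {k}, φ ⁻¹' {j} := by
    ext i; simp
  rw [h, finsum_mem_biUnion]
  · intro a _ b _ hab
    exact (Set.disjoint_singleton.2 hab).preimage φ
  · exact Set.toFinite _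
  · intro j _; exact Set.toFinite _

end PushPull

/-! ### `(FinSet, +)` and the slice `(FinSet/[2], +)` as symmetric monoidal categories -/

/-- Finite sets with disjoint union and the empty set. -/
instance finSetStruct : MonoidalCategoryStruct FintypeCat.{0} where
  tensorObj X Y := FintypeCat.of (X ⊕ Y)
  whiskerLeft X _ _ g := FintypeCat.homMk (Sum.map (fun x : X => x) g)
  whiskerRight f Y := FintypeCat.homMk (Sum.map f (fun y : Y => y))
  tensorHom f g := FintypeCat.homMk (Sum.map f g)
  tensorUnit := FintypeCat.of Empty
  associator X Y Z := FintypeCat.equivEquivIso (Equiv.sumAssoc X Y Z)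
  leftUnitor X := FintypeCat.equivEquivIso (Equiv.emptySum Empty X)
  rightUnitor X := FintypeCat.equivEquivIso (Equiv.sumEmpty X Empty)

instance finSetMonoidal : MonoidalCategory FintypeCat.{0} where
  tensorHom_def _ _ := by apply FintypeCat.hom_ext; rintro (x | x) <;> rfl
  id_tensorHom_id _ _ := by apply FintypeCat.hom_ext; rintro (x | x) <;> rfl
  tensorHom_comp_tensorHom _ _ _ _ := by apply FintypeCat.hom_ext; rintro (x | x) <;> rfl
  whiskerLeft_id _ _ := by apply FintypeCat.hom_ext; rintro (x | x) <;> rfl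
  id_whiskerRight _ _ := by apply FintypeCat.hom_ext; rintro (x | x) <;> rfl
  associator_naturality _ _ _ := by apply FintypeCat.hom_ext; rintro ((x | x) | x) <;> rfl
  leftUnitor_naturality _ := by apply FintypeCat.hom_ext; rintro (⟨⟨⟩⟩ | x); rfl
  rightUnitor_naturality _ := by apply FintypeCat.hom_ext; rintro (x | ⟨⟨⟩⟩); rfl
  pentagon _ _ _ _ := by apply FintypeCat.hom_ext; rintro (((x | x) | x) | x) <;> rfl
  triangle _ _ := by apply FintypeCat.hom_ext; rintro ((x | ⟨⟨⟩⟩) | x) <;> rfl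

instance finSetSymmetric : SymmetricCategory FintypeCat.{0} where
  braiding X Y := FintypeCat.equivEquivIso (Equiv.sumComm X Y)
  braiding_naturality_right _ _ _ _ := by apply FintypeCat.hom_ext; rintro (x | x) <;> rfl
  braiding_naturality_left _ _ := by apply FintypeCat.hom_ext; rintro (x | x) <;> rfl
  hexagon_forward _ _ _ := by apply FintypeCat.hom_ext; rintro ((x | x) | x) <;> rfl
  hexagon_reverse _ _ _ := by apply FintypeCat.hom_ext; rintro (x | (x | x)) <;> rfl
  symmetry _ _ := by apply FintypeCat.hom_ext; rintro (x | x) <;> rfl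

/-- The two-element set `[2]` of labels: `0` means convex, `1` means concave. -/
abbrev labels : FintypeCat.{0} := FintypeCat.of (Fin 2)

/-- The slice category `FinSet/[2]`: its objects are the labelled finite sets `τ : N → [2]`. -/
abbrev LabelledFinSet := Over labels

theorem labelled_hom_ext {X Y : LabelledFinSet} {f g : X ⟶ Y}
    (h : ∀ i : X.left, f.left i = g.left i) : f = g :=
  Over.OverMorphism.ext (FintypeCat.hom_ext _ _ h)

theorem label_map {X Y : LabelledFinSet} (f : X ⟶ Y) (i : X.left) :
    Y.hom (f.left i) = X.hom i :=
  ConcreteCategory.congr_hom (Over.w f) i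

/-- Morphisms of `FinSet/[2]` from label-preserving functions. -/
def labelledHom {X Y : LabelledFinSet} (f : X.left → Y.left)
    (h : ∀ i, Y.hom (f i) = X.hom i) : X ⟶ Y :=
  Over.homMk (FintypeCat.homMk f) (FintypeCat.hom_ext _ _ h)

/-- Isomorphisms of `FinSet/[2]` from label-preserving bijections. -/
def labelledIso {X Y : LabelledFinSet} (e : X.left ≃ Y.left)
    (h : ∀ i, Y.hom (e i) = X.hom i) : X ≅ Y where
  hom := labelledHom e h
  inv := labelledHom e.symm (fun j => by rw [← h, e.apply_symm_apply])
  hom_inv_id := labelled_hom_ext fun i => e.symm_apply_apply i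
  inv_hom_id := labelled_hom_ext fun i => e.apply_symm_apply i

/-- The disjoint union of labelled finite sets, labelled by the copairing. -/
def labelledSum (X Y : LabelledFinSet) : LabelledFinSet :=
  Over.mk (Y := X.left ⊗ Y.left)
    (FintypeCat.homMk (X := X.left ⊗ Y.left) (Y := labels) (Sum.elim X.hom Y.hom))

instance labelledStruct : MonoidalCategoryStruct LabelledFinSet where
  tensorObj := labelledSum
  whiskerLeft X _ _ g := labelledHom (X := labelledSum _ _) (Y := labelledSum _ _)
    (Sum.map (fun x : X.left => x) g.left)
    (by rintro (x | x); exacts [rfl, label_map g x])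
  whiskerRight f Y := labelledHom (X := labelledSum _ _) (Y := labelledSum _ _)
    (Sum.map f.left (fun y : Y.left => y))
    (by rintro (x | x); exacts [label_map f x, rfl])
  tensorHom f g := labelledHom (X := labelledSum _ _) (Y := labelledSum _ _)
    (Sum.map f.left g.left)
    (by rintro (x | x); exacts [label_map f x, label_map g x])
  tensorUnit := Over.mk (Y := 𝟙_ FintypeCat.{0})
    (FintypeCat.homMk (X := 𝟙_ FintypeCat.{0}) (Y := labels) Empty.elim)
  associator X Y Z := labelledIso (X := labelledSum _ _) (Y := labelledSum _ _)
    (Equiv.sumAssoc X.left Y.left Z.left) (by rintro ((x | x) | x) <;> rfl)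
  leftUnitor X := labelledIso (X := labelledSum _ _)
    (Equiv.emptySum Empty X.left) (by rintro (⟨⟨⟩⟩ | x); rfl)
  rightUnitor X := labelledIso (X := labelledSum _ _)
    (Equiv.sumEmpty X.left Empty) (by rintro (x | ⟨⟨⟩⟩); rfl)

instance labelledMonoidal : MonoidalCategory LabelledFinSet where
  tensorHom_def _ _ := by apply labelled_hom_ext; rintro (x | x) <;> rfl
  id_tensorHom_id _ _ := by apply labelled_hom_ext; rintro (x | x) <;> rfl
  tensorHom_comp_tensorHom _ _ _ _ := by apply labelled_hom_ext; rintro (x | x) <;> rfl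
  whiskerLeft_id _ _ := by apply labelled_hom_ext; rintro (x | x) <;> rfl
  id_whiskerRight _ _ := by apply labelled_hom_ext; rintro (x | x) <;> rfl
  associator_naturality _ _ _ := by apply labelled_hom_ext; rintro ((x | x) | x) <;> rfl
  leftUnitor_naturality _ := by apply labelled_hom_ext; rintro (⟨⟨⟩⟩ | x); rfl
  rightUnitor_naturality _ := by apply labelled_hom_ext; rintro (x | ⟨⟨⟩⟩); rfl
  pentagon _ _ _ _ := by apply labelled_hom_ext; rintro (((x | x) | x) | x) <;> rfl
  triangle _ _ := by apply labelled_hom_ext; rintro ((x | ⟨⟨⟩⟩) | x) <;> rfl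

instance labelledSymmetric : SymmetricCategory LabelledFinSet where
  braiding X Y := labelledIso (X := labelledSum _ _) (Y := labelledSum _ _)
    (Equiv.sumComm X.left Y.left) (by rintro (x | x) <;> rfl)
  braiding_naturality_right _ _ _ _ := by apply labelled_hom_ext; rintro (x | x) <;> rfl
  braiding_naturality_left _ _ := by apply labelled_hom_ext; rintro (x | x) <;> rfl
  hexagon_forward _ _ _ := by apply labelled_hom_ext; rintro ((x | x) | x) <;> rfl
  hexagon_reverse _ _ _ := by apply labelled_hom_ext; rintro (x | (x | x)) <;> rfl
  symmetry _ _ := by apply labelled_hom_ext; rintro (x | x) <;> rfl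

/-- The forgetful functor `U : FinSet/[2] ⥤ FinSet`, `(τ : N → [2]) ↦ N`. -/
abbrev U : LabelledFinSet ⥤ FintypeCat.{0} := Over.forget labels

instance forgetCore : U.Monoidal :=
  Functor.CoreMonoidal.toMonoidal
    { εIso := Iso.refl _
      μIso := fun _ _ => Iso.refl _
      μIso_hom_natural_left := fun _ _ => by
        apply FintypeCat.hom_ext; rintro (x | x) <;> rfl
      μIso_hom_natural_right := fun _ _ => by
        apply FintypeCat.hom_ext; rintro (x | x) <;> rfl
      associativity := fun _ _ _ => by
        apply FintypeCat.hom_ext; rintro ((x | x) | x) <;> rfl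
      left_unitality := fun _ => by
        apply FintypeCat.hom_ext; rintro (⟨⟨⟩⟩ | x); rfl
      right_unitality := fun _ => by
        apply FintypeCat.hom_ext; rintro (x | ⟨⟨⟩⟩); rfl }

instance forgetBraided : U.Braided where
  braided _ _ := by apply FintypeCat.hom_ext; rintro (x | x) <;> rfl

/-! ### The lax symmetric monoidal functor `NDD` of non-deterministic dynamical systems -/

/-- Non-deterministic dynamical systems `ℝ^N → P(ℝ^N)`. -/
abbrev NDSystem (N : Type) : Type := (N → ℝ) → Set (N → ℝ)

/-- `v ↦ P(φ_*) ∘ v ∘ φ^*`. -/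
def nddMap {N M : Type} [Finite N] (φ : N → M) (v : NDSystem N) : NDSystem M :=
  fun z => push φ '' v (pull φ z)

/-- The product comparison
`(υ, ρ) ↦ P(ι_{N*}) ∘ υ ∘ ι_N^* ⊞ P(ι_{M*}) ∘ ρ ∘ ι_M^*` (Minkowski sum). -/
def nddProd {N M : Type} [Finite N] [Finite M] (v : NDSystem N) (w : NDSystem M) :
    NDSystem (N ⊕ M) :=
  fun z => push (Sum.inl : N → N ⊕ M) '' v (pull Sum.inl z) +
    push (Sum.inr : M → N ⊕ M) '' w (pull Sum.inr z)

/-- The functor `NDD : FinSet ⥤ Set`. -/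
def NDD : FintypeCat.{0} ⥤ Type where
  obj N := NDSystem N
  map φ := TypeCat.ofHom (nddMap φ)
  map_id N := by
    refine ConcreteCategory.hom_ext _ _ fun v => ?_
    funext z
    change push (fun i : N => i) '' v z = v z
    simp only [push_id, Set.image_id']
  map_comp φ ψ := by
    refine ConcreteCategory.hom_ext _ _ fun v => ?_
    funext z
    change push (fun i => ψ (φ i)) '' v (pull (fun i => ψ (φ i)) z) =
      push ψ '' (push φ '' v (pull φ (pull ψ z)))
    simp only [Set.image_image, push_push]
    rfl

instance nddLax : NDD.LaxMonoidal where
  ε := TypeCat.ofHom fun _ => fun _ => {0}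
  μ N M := TypeCat.ofHom fun p => nddProd p.1 p.2
  μ_natural_left {N M} φ K := by
    ext ⟨v, w⟩
    funext z
    change push _ '' (push φ '' v _) + push _ '' w _ = push (Sum.map φ (fun y : K => y)) ''
      (push _ '' v _ + push _ '' w _)
    simp only [Set.image_add, Set.image_image, push_push]
    rfl
  μ_natural_right {N M} K φ := by
    ext ⟨v, w⟩
    funext z
    change push _ '' v _ + push _ '' (push φ '' w _) = push (Sum.map (fun y : K => y) φ) ''
      (push _ '' v _ + push _ '' w _)
    simp only [Set.image_add, Set.image_image, push_push]
    rfl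
  associativity N M K := by
    ext ⟨⟨v, w⟩, t⟩
    funext z
    change push (Equiv.sumAssoc N M K) '' (push _ '' (push _ '' v _ + push _ '' w _) +
      push _ '' t _) = push _ '' v _ + push _ '' (push _ '' w _ + push _ '' t _)
    simp only [Set.image_add, Set.image_image, push_push, add_assoc]
    rfl
  left_unitality N := by
    ext ⟨_, v⟩
    funext z
    change v z = push (Equiv.emptySum Empty N) '' (push (Sum.inl : Empty → Empty ⊕ N) '' {0} +
      push (Sum.inr : N → Empty ⊕ N) '' v z)
    rw [Set.image_singleton, map_zero, Set.singleton_zero, zero_add, Set.image_image]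
    simp only [push_push]
    exact (by simp only [push_id, Set.image_id'] : v z = push (fun i : N => i) '' v z)
  right_unitality N := by
    ext ⟨v, _⟩
    funext z
    change v z = push (Equiv.sumEmpty N Empty) '' (push (Sum.inl : N → N ⊕ Empty) '' v z +
      push (Sum.inr : Empty → N ⊕ Empty) '' {0})
    rw [Set.image_singleton, map_zero, Set.singleton_zero, add_zero, Set.image_image]
    simp only [push_push]
    exact (by simp only [push_id, Set.image_id'] : v z = push (fun i : N => i) '' v z)

instance nddLaxBraided : NDD.LaxBraided where
  braided N M := by
    ext ⟨v, w⟩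
    funext z
    change push (Equiv.sumComm N M) '' (push _ '' v _ + push _ '' w _) =
      push _ '' w _ + push _ '' v _
    simp only [Set.image_add, Set.image_image, push_push]
    exact add_comm _ _

/-! ### The lax symmetric monoidal functor `Saddle` -/

section SaddleFunctions

variable {N M : Type}

/-- The convex-labelled elements `N₁ = τ⁻¹(convex)` of a labelled set. -/
abbrev Cvx (τ : N → Fin 2) : Type := {i : N // τ i = 0}

/-- The concave-labelled elements `N₂ = τ⁻¹(concave)` of a labelled set. -/
abbrev Ccv (τ : N → Fin 2) : Type := {i : N // τ i = 1}

theorem label_eq_one {a : Fin 2} (h : ¬ a = 0) : a = 1 := by omega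

/-- The isomorphism `u : ℝ^{N₁} ⊕ ℝ^{N₂} ≅ ℝ^N` which arranges a block of convex-labelled
coordinates and a block of concave-labelled coordinates into one vector. -/
def join (τ : N → Fin 2) (x : Cvx τ → ℝ) (y : Ccv τ → ℝ) : N → ℝ :=
  fun i => if h : τ i = 0 then x ⟨i, h⟩ else y ⟨i, label_eq_one h⟩

/-- The block of convex-labelled coordinates of a vector. -/
def cvxPart (τ : N → Fin 2) (z : N → ℝ) : Cvx τ → ℝ := fun i => z i

/-- The block of concave-labelled coordinates of a vector. -/
def ccvPart (τ : N → Fin 2) (z : N → ℝ) : Ccv τ → ℝ := fun i => z i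

theorem join_parts (τ : N → Fin 2) (z : N → ℝ) : join τ (cvxPart τ z) (ccvPart τ z) = z := by
  funext i
  unfold join
  split <;> rfl

theorem cvxPart_join (τ : N → Fin 2) (x : Cvx τ → ℝ) (y : Ccv τ → ℝ) :
    cvxPart τ (join τ x y) = x := by
  funext ⟨i, h⟩
  exact dif_pos h

theorem ccvPart_join (τ : N → Fin 2) (x : Cvx τ → ℝ) (y : Ccv τ → ℝ) :
    ccvPart τ (join τ x y) = y := by
  funext ⟨i, h⟩
  exact dif_neg (by rw [h]; exact one_ne_zero)

/-- `f : ℝ^N → ℝ` is a saddle function for the labelling `τ`: it is convex in the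
convex-labelled block for each fixed value of the concave-labelled block, and concave in the
concave-labelled block for each fixed value of the convex-labelled block. -/
def IsSaddle (τ : N → Fin 2) (f : (N → ℝ) → ℝ) : Prop :=
  (∀ y : Ccv τ → ℝ, ConvexOn ℝ Set.univ fun x => f (join τ x y)) ∧
    ∀ x : Cvx τ → ℝ, ConcaveOn ℝ Set.univ fun y => f (join τ x y)

theorem pull_join {τ : N → Fin 2} {σ : M → Fin 2} (φ : N → M) (h : ∀ i, σ (φ i) = τ i)
    (x : Cvx σ → ℝ) (y : Ccv σ → ℝ) :
    pull φ (join σ x y) =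
      join τ (pull (fun i : Cvx τ => (⟨φ i.1, (h i.1).trans i.2⟩ : Cvx σ)) x)
        (pull (fun i : Ccv τ => (⟨φ i.1, (h i.1).trans i.2⟩ : Ccv σ)) y) := by
  funext i
  simp only [pull_apply, join, h i]

theorem IsSaddle.comp_pull {τ : N → Fin 2} {σ : M → Fin 2} {f : (N → ℝ) → ℝ}
    (hf : IsSaddle τ f) (φ : N → M) (h : ∀ i, σ (φ i) = τ i) :
    IsSaddle σ fun z => f (pull φ z) := by
  constructor
  · intro y
    simp only [pull_join φ h]
    exact (hf.1 _).comp_linearMap (pull _)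
  · intro x
    simp only [pull_join φ h]
    exact (hf.2 _).comp_linearMap (pull _)

theorem IsSaddle.add {τ : N → Fin 2} {f g : (N → ℝ) → ℝ} (hf : IsSaddle τ f)
    (hg : IsSaddle τ g) : IsSaddle τ fun z => f z + g z :=
  ⟨fun y => (hf.1 y).add (hg.1 y), fun x => (hf.2 x).add (hg.2 x)⟩

theorem isSaddle_zero (τ : N → Fin 2) : IsSaddle τ fun _ => 0 :=
  ⟨fun _ => convexOn_const 0 convex_univ, fun _ => concaveOn_const 0 convex_univ⟩

end SaddleFunctions

/-- The set of saddle functions on the labelled finite set `X`. -/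
abbrev SaddleFun (X : LabelledFinSet) : Type :=
  {f : (X.left → ℝ) → ℝ // IsSaddle (fun i => X.hom i) f}

/-- Precomposition with `φ^*`. -/
def saddleMap {X Y : LabelledFinSet} (φ : X ⟶ Y) (f : SaddleFun X) : SaddleFun Y :=
  ⟨fun z => f.1 (pull φ.left z), f.2.comp_pull φ.left (label_map φ)⟩

/-- The product comparison `(f, g) ↦ (z ↦ f (ι_N^* z) + g (ι_M^* z))`. -/
def saddleProd {X Y : LabelledFinSet} (f : SaddleFun X) (g : SaddleFun Y) :
    SaddleFun (X ⊗ Y) :=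
  ⟨fun z : (X.left ⊕ Y.left) → ℝ => f.1 (pull Sum.inl z) + g.1 (pull Sum.inr z),
    IsSaddle.add (f.2.comp_pull (Sum.inl : X.left → X.left ⊕ Y.left) fun _ => rfl)
      (g.2.comp_pull (Sum.inr : Y.left → X.left ⊕ Y.left) fun _ => rfl)⟩

/-- The functor `Saddle : FinSet/[2] ⥤ Set`. -/
def Saddle : LabelledFinSet ⥤ Type where
  obj X := SaddleFun X
  map φ := TypeCat.ofHom (saddleMap φ)
  map_id _ := rfl
  map_comp _ _ := rfl

instance saddleLax : Saddle.LaxMonoidal where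
  ε := TypeCat.ofHom fun _ => ⟨fun _ => 0, isSaddle_zero _⟩
  μ X Y := TypeCat.ofHom fun p => saddleProd p.1 p.2
  μ_natural_left _ _ := rfl
  μ_natural_right _ _ := rfl
  associativity X Y Z := by
    ext ⟨⟨f, g⟩, h⟩
    exact Subtype.ext (funext fun z => add_assoc _ _ _)
  left_unitality X := by
    ext ⟨_, f⟩
    exact Subtype.ext (funext fun z => (zero_add _).symm)
  right_unitality X := by
    ext ⟨f, _⟩
    exact Subtype.ext (funext fun z => (add_zero _).symm)

instance saddleLaxBraided : Saddle.LaxBraided where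
  braided X Y := by
    ext ⟨f, g⟩
    exact Subtype.ext (funext fun z => add_comm _ _)

/-! ### Subgradients and supergradients -/

/-- The subdifferential of `g : ℝ^n → ℝ` at `x`. -/
def subdifferential {n : Type} [Finite n] (g : (n → ℝ) → ℝ) (x : n → ℝ) : Set (n → ℝ) :=
  {v | ∀ y, g y - g x ≥ ∑ᶠ i, v i * (y i - x i)}

/-- The superdifferential of `g : ℝ^n → ℝ` at `x`. -/
def superdifferential {n : Type} [Finite n] (g : (n → ℝ) → ℝ) (x : n → ℝ) : Set (n → ℝ) :=
  {w | ∀ y, g y - g x ≤ ∑ᶠ i, w i * (y i - x i)}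

/-- The subdifferential at `x` of a saddle function with respect to the convex-labelled block of
variables, the concave-labelled block being held fixed. -/
def cvxSubdifferential {N : Type} [Finite N] (τ : N → Fin 2) (f : (N → ℝ) → ℝ) (x : N → ℝ) :
    Set (Cvx τ → ℝ) :=
  subdifferential (fun a => f (join τ a (ccvPart τ x))) (cvxPart τ x)

/-- The superdifferential at `x` of a saddle function with respect to the concave-labelled block
of variables, the convex-labelled block being held fixed. -/
def ccvSuperdifferential {N : Type} [Finite N] (τ : N → Fin 2) (f : (N → ℝ) → ℝ) (x : N → ℝ) :
    Set (Ccv τ → ℝ) :=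
  superdifferential (fun b => f (join τ (cvxPart τ x) b)) (ccvPart τ x)

/-- The primal-dual subgradient system of `f` for the labelling `τ`: the possible update
directions at `x` are the vectors whose convex-labelled coordinates are those of `-p` and whose
concave-labelled coordinates are those of `q`, for a subgradient `p` with respect to the
convex-labelled block and a supergradient `q` with respect to the concave-labelled block. -/
def pdSubgradient {N : Type} [Finite N] (τ : N → Fin 2) (f : (N → ℝ) → ℝ) : NDSystem N :=
  fun x => {v | ∃ p ∈ cvxSubdifferential τ f x, ∃ q ∈ ccvSuperdifferential τ f x,
    v = join τ (-p) q}

end PDSubg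

/-! Naturality is a chain rule: for convex `g` on `ℝ^N`, the subdifferential of `g ∘ φ^*` at `z` is
the image under `φ_*` of the subdifferential of `g` at `φ^* z` (`subdifferential_comp_pull`). One
inclusion is the adjointness of `φ_*` and `φ^*`. The other is Hahn–Banach
(`exists_subgradient_comp_eq`): `g` is finite on a finite-dimensional space, hence continuous, so
its strict epigraph is open and no qualification condition is needed. Concave functions follow by
negation. A label-preserving `φ` makes `φ^*` and `φ_*` block diagonal (`pull_join`, `push_join`),
and `p` and `q` are chosen independently, so the chain rule is applied in each block separately.

Compatibility with products needs only the defining inequalities: freezing one summand of a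
separable sum isolates the condition on the other, and adding the two conditions recovers the joint
one. For the unit, `ℝ^∅` is a single point. -/

namespace PDSubg

/-! ### Chain rule for sub- and superdifferentials along pullbacks -/

section ConvexAnalysis

/-- A linear functional dominated by a convex function along a linear map `A` is the
composite with `A` of a linear functional dominated by the convex function. -/
theorem exists_subgradient_comp_eq {E F : Type*} [NormedAddCommGroup E] [NormedSpace ℝ E]
    [FiniteDimensional ℝ E] [AddCommGroup F] [Module ℝ F] {g : E → ℝ}
    (hg : ConvexOn ℝ Set.univ g) (A : F →ₗ[ℝ] E) (w : F →ₗ[ℝ] ℝ) (x : F)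
    (hw : ∀ y, w (y - x) ≤ g (A y) - g (A x)) :
    ∃ v : E →ₗ[ℝ] ℝ, (∀ e, v (e - A x) ≤ g e - g (A x)) ∧ ∀ y, v (A y) = w y := by
  have hcont : Continuous g :=
    continuousOn_univ.1 (hg.continuousOn isOpen_univ)
  -- `S` is the strict epigraph of `g`; `T` transports to `E × ℝ` the graph of the affine minorant
  -- given by `w`. The bound `hw` says that `T` never enters `S`.
  let S : Set (E × ℝ) := {p | g p.1 < p.2}
  let T : Set (E × ℝ) := Set.range fun y : F => (A y, g (A x) + w (y - x))
  have hS : Convex ℝ S := by simpa [S] using hg.convex_strict_epigraph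
  have hSo : IsOpen S := isOpen_lt (hcont.comp continuous_fst) continuous_snd
  have hT : Convex ℝ T := by
    rintro _ ⟨y, rfl⟩ _ ⟨z, rfl⟩ a b _ _ hab
    refine ⟨a • y + b • z, Prod.ext (by simp) ?_⟩
    simp only [map_sub, map_add, map_smul, smul_eq_mul, Prod.snd_add, Prod.smul_snd]
    linear_combination (w x - g (A x)) * hab
  have hdisj : Disjoint S T := by
    rw [Set.disjoint_left]
    rintro _ hp ⟨y, rfl⟩
    have h : g (A y) < g (A x) + w (y - x) := hp
    linarith [hw y]
  obtain ⟨F', u, hlt, hle⟩ := geometric_hahn_banach_open hS hSo hT hdisj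
  let l : E →ₗ[ℝ] ℝ := F'.toLinearMap ∘ₗ LinearMap.inl ℝ E ℝ
  let c : ℝ := F' (0, 1)
  have hF (e : E) (s : ℝ) : F' (e, s) = l e + s * c := by
    have h : (e, s) = (e, (0 : ℝ)) + s • ((0 : E), (1 : ℝ)) := by simp
    rw [h, map_add, map_smul]
    rfl
  have hlow (y : F) : u ≤ l (A y) + (g (A x) + w (y - x)) * c := by
    rw [← hF]; exact hle _ ⟨y, rfl⟩
  have hup (e : E) (s : ℝ) (h : g e < s) : l e + s * c < u := by
    rw [← hF]; exact hlt _ h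
  -- The separating hyperplane is not vertical: compare a point of `S` and a point of `T`, both over
  -- `A x`.
  have hc : c < 0 := by
    have h₁ := hup (A x) (g (A x) + 1) (by linarith)
    have h₂ := hlow x
    simp only [sub_self, map_zero, add_zero] at h₂
    linarith
  -- The bound passes to the closed epigraph; the height excess `ε / (-c)` costs exactly `ε` after
  -- multiplication by `c`.
  have hup' (e : E) : l e + g e * c ≤ u := by
    refine le_of_forall_pos_le_add fun ε hε => ?_
    have h := hup e (g e + ε / (-c)) (by linarith [div_pos hε (neg_pos.2 hc)])
    have h' : ε / (-c) * c = -ε := by field_simp [hc.ne]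
    rw [add_mul, h'] at h
    linarith
  have hx : u ≤ l (A x) + g (A x) * c := by simpa using hlow x
  -- Along the line `x + t • y` the functional stays above its value at `t = 0`; being affine in
  -- `t`, it is constant.
  have hzero (y : F) : l (A y) + w y * c = 0 := by
    have key (t : ℝ) : 0 ≤ t * (l (A y) + w y * c) := by
      have h := hlow (x + t • y)
      have h' := hup' (A x)
      simp only [add_sub_cancel_left, map_add, map_smul, smul_eq_mul] at h
      linarith
    linarith [key 1, key (-1)]
  -- Dividing by `-c > 0` normalises the vertical coefficient to `-1`, so that `hzero` says the
  -- functional restricts to `w` along `A`.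
  refine ⟨(-c⁻¹) • l, fun e => ?_, fun y => ?_⟩
  · have h := hup' e
    have h' : l (e - A x) ≤ (g e - g (A x)) * (-c) := by
      rw [map_sub]; linarith
    have h'' : (-c⁻¹) * l (e - A x) = l (e - A x) / (-c) := by
      rw [div_eq_mul_inv, inv_neg]; ring
    rw [LinearMap.smul_apply, smul_eq_mul, h'', div_le_iff₀ (neg_pos.2 hc)]
    exact h'
  · have h : l (A y) = -(w y * c) := by linarith [hzero y]
    rw [LinearMap.smul_apply, smul_eq_mul, h]
    field_simp [hc.ne]

variable {N M : Type} [Finite N] [Finite M]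

/-- Adjointness of `φ_*` and `φ^*`: each `i` lies in exactly one fibre, the one over `φ i`. -/
theorem finsum_push_mul (φ : N → M) (v : N → ℝ) (y : M → ℝ) :
    ∑ᶠ j, push φ v j * y j = ∑ᶠ i, v i * y (φ i) := by
  classical
  have := Fintype.ofFinite N
  have := Fintype.ofFinite M
  simp only [push_apply, finsum_eq_sum_of_fintype, Finset.sum_mul]
  rw [Finset.sum_comm]
  refine Finset.sum_congr rfl fun i _ => ?_
  rw [Finset.sum_eq_single (φ i)]
  · simp
  · intro j _ hj
    simp [hj.symm]
  · simp

theorem eq_of_finsum_mul_eq {v w : N → ℝ} (h : ∀ y : N → ℝ, ∑ᶠ i, v i * y i = ∑ᶠ i, w i * y i) :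
    v = w := by
  classical
  have := Fintype.ofFinite N
  funext i
  simpa [finsum_eq_sum_of_fintype, Pi.single_apply] using h (Pi.single i 1)

/-- The subdifferential of a convex function precomposed with a pullback. -/
theorem subdifferential_comp_pull {g : (N → ℝ) → ℝ} (hg : ConvexOn ℝ Set.univ g) (φ : N → M)
    (z : M → ℝ) :
    subdifferential (fun y => g (pull φ y)) z = push φ '' subdifferential g (pull φ z) := by
  ext w
  constructor
  · intro hw
    have := Fintype.ofFinite N
    have := Fintype.ofFinite M
    obtain ⟨v, hv, hvw⟩ := exists_subgradient_comp_eq hg (pull φ)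
      (Fintype.linearCombination ℝ w) z fun y => by
        have h := hw y
        simpa [Fintype.linearCombination_apply, finsum_eq_sum_of_fintype, mul_comm] using h
    classical
    -- The functional from Hahn–Banach becomes a vector through its values on the standard basis;
    -- adjointness then identifies the pushforward of that vector with `w`.
    have hrep (e : N → ℝ) : v e = ∑ᶠ i, v (Pi.single i 1) * e i := by
      rw [finsum_eq_sum_of_fintype, LinearMap.pi_apply_eq_sum_univ v e]
      refine Finset.sum_congr rfl fun i _ => ?_
      rw [smul_eq_mul, mul_comm]
      congr 2
      funext j
      simp [Pi.single_apply, eq_comm]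
    refine ⟨fun i => v (Pi.single i 1), fun y => ?_, eq_of_finsum_mul_eq fun y => ?_⟩
    · have h := hv y
      rw [hrep] at h
      exact h
    · rw [finsum_push_mul]
      refine (hrep (pull φ y)).symm.trans ((hvw y).trans ?_)
      simp [Fintype.linearCombination_apply, finsum_eq_sum_of_fintype, mul_comm]
  · rintro ⟨v, hv, rfl⟩ y
    rw [finsum_push_mul φ v fun j => y j - z j]
    exact hv (pull φ y)

theorem neg_mem_subdifferential_neg {g : (N → ℝ) → ℝ} {x w : N → ℝ} :
    -w ∈ subdifferential (fun y => -g y) x ↔ w ∈ superdifferential g x := by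
  refine forall_congr' fun y => ?_
  simp only [Pi.neg_apply, neg_mul, finsum_neg_distrib]
  constructor <;> intro h <;> linarith

/-- The superdifferential of a concave function precomposed with a pullback. -/
theorem superdifferential_comp_pull {g : (N → ℝ) → ℝ} (hg : ConcaveOn ℝ Set.univ g) (φ : N → M)
    (z : M → ℝ) :
    superdifferential (fun y => g (pull φ y)) z = push φ '' superdifferential g (pull φ z) := by
  ext w
  rw [← neg_mem_subdifferential_neg, subdifferential_comp_pull (g := fun y => -g y) hg.neg]
  constructor
  · rintro ⟨v, hv, h⟩
    exact ⟨-v, neg_mem_subdifferential_neg.1 (by simpa using hv), by rw [map_neg, h, neg_neg]⟩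
  · rintro ⟨v, hv, rfl⟩
    exact ⟨-v, neg_mem_subdifferential_neg.2 hv, map_neg _ _⟩

end ConvexAnalysis

/-! ### Block decomposition and naturality -/

section Blocks

variable {N M : Type} [Finite N] {τ : N → Fin 2} {σ : M → Fin 2}

/-- Every element of the fibre over `j` carries the label of `j`, so each fibre sum involves a
single block. -/
theorem push_join (φ : N → M) (h : ∀ i, σ (φ i) = τ i) (p : Cvx τ → ℝ) (q : Ccv τ → ℝ) :
    push φ (join τ p q) =
      join σ (push (fun i : Cvx τ => (⟨φ i.1, (h i.1).trans i.2⟩ : Cvx σ)) p)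
        (push (fun i : Ccv τ => (⟨φ i.1, (h i.1).trans i.2⟩ : Ccv σ)) q) := by
  funext j
  rw [push_apply, join]
  split_ifs with hj
  · symm
    refine finsum_mem_eq_of_bijOn Subtype.val ⟨?_, Subtype.val_injective.injOn, ?_⟩ ?_
    · intro i hi
      exact congrArg Subtype.val hi
    · rintro i rfl
      exact ⟨⟨i, (h i).symm.trans hj⟩, rfl, rfl⟩
    · rintro ⟨i, hi⟩ _
      exact (congrFun (cvxPart_join τ p q) ⟨i, hi⟩).symm
  · symm
    refine finsum_mem_eq_of_bijOn Subtype.val ⟨?_, Subtype.val_injective.injOn, ?_⟩ ?_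
    · intro i hi
      exact congrArg Subtype.val hi
    · rintro i rfl
      exact ⟨⟨i, (h i).symm.trans (label_eq_one hj)⟩, rfl, rfl⟩
    · rintro ⟨i, hi⟩ _
      exact (congrFun (ccvPart_join τ p q) ⟨i, hi⟩).symm

/-- Primal-dual subgradient systems are natural in label-preserving functions. -/
theorem pdSubgradient_comp_pull [Finite M] {f : (N → ℝ) → ℝ} (hf : IsSaddle τ f) (φ : N → M)
    (h : ∀ i, σ (φ i) = τ i) :
    pdSubgradient σ (fun z => f (pull φ z)) = nddMap φ (pdSubgradient τ f) := by
  funext z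
  have h₁ : cvxSubdifferential σ (fun z => f (pull φ z)) z =
      push (fun i : Cvx τ => (⟨φ i.1, (h i.1).trans i.2⟩ : Cvx σ)) ''
        cvxSubdifferential τ f (pull φ z) := by
    rw [cvxSubdifferential]
    -- With the concave block frozen, the slice of `f ∘ φ^*` is a convex slice of `f` precomposed
    -- with the pullback along the restriction of `φ` to convex labels.
    simp only [pull_join φ h]
    exact subdifferential_comp_pull (hf.1 _) _ _
  have h₂ : ccvSuperdifferential σ (fun z => f (pull φ z)) z =
      push (fun i : Ccv τ => (⟨φ i.1, (h i.1).trans i.2⟩ : Ccv σ)) ''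
        ccvSuperdifferential τ f (pull φ z) := by
    rw [ccvSuperdifferential]
    simp only [pull_join φ h]
    exact superdifferential_comp_pull (hf.2 _) _ _
  ext v
  -- Both sides are now parametrised by the same pairs `(p, q)`; linearity of the pushforward
  -- absorbs the sign on `p`.
  simp only [pdSubgradient, nddMap, h₁, h₂, Set.mem_ofPred_eq, Set.exists_mem_image]
  constructor
  · rintro ⟨p, hp, q, hq, rfl⟩
    exact ⟨_, ⟨p, hp, q, hq, rfl⟩, by rw [push_join φ h, map_neg]⟩
  · rintro ⟨_, ⟨p, hp, q, hq, rfl⟩, rfl⟩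
    exact ⟨p, hp, q, hq, by rw [push_join φ h, map_neg]⟩

/-! ### Separable sums and the unit -/

/-- The pairing of `ℝ^N` splits over the two blocks of coordinates. -/
theorem finsum_mul_eq_add_blocks (τ : N → Fin 2) (v y : N → ℝ) :
    ∑ᶠ i, v i * y i =
      ∑ᶠ i, cvxPart τ v i * cvxPart τ y i + ∑ᶠ i, ccvPart τ v i * ccvPart τ y i := by
  classical
  have := Fintype.ofFinite N
  simp only [finsum_eq_sum_of_fintype]
  rw [← Fintype.sum_subtype_add_sum_subtype (fun i => τ i = 0)]
  refine congrArg _ (Fintype.sum_equiv (Equiv.subtypeEquivRight fun i => ?_) _ _ fun _ => rfl)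
  omega

/-- Membership in the primal-dual subgradient system, tested on vectors of the whole space. -/
theorem mem_pdSubgradient_iff {f : (N → ℝ) → ℝ} {x v : N → ℝ} :
    v ∈ pdSubgradient τ f x ↔
      (∀ y, ccvPart τ y = ccvPart τ x → f y - f x ≥ -∑ᶠ i, v i * (y i - x i)) ∧
        ∀ y, cvxPart τ y = cvxPart τ x → f y - f x ≤ ∑ᶠ i, v i * (y i - x i) := by
  have hcvx (p : Cvx τ → ℝ) : p ∈ cvxSubdifferential τ f x ↔
      ∀ y, ccvPart τ y = ccvPart τ x →
        f y - f x ≥ ∑ᶠ i, p i * (cvxPart τ y i - cvxPart τ x i) := by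
    constructor
    · intro h y hy
      have h' := h (cvxPart τ y)
      dsimp only at h'
      rwa [join_parts, ← hy, join_parts] at h'
    · intro h a
      have h' := h (join τ a (ccvPart τ x)) (ccvPart_join _ _ _)
      rw [cvxPart_join] at h'
      simpa only [join_parts] using h'
  have hccv (q : Ccv τ → ℝ) : q ∈ ccvSuperdifferential τ f x ↔
      ∀ y, cvxPart τ y = cvxPart τ x →
        f y - f x ≤ ∑ᶠ i, q i * (ccvPart τ y i - ccvPart τ x i) := by
    constructor
    · intro h y hy
      have h' := h (ccvPart τ y)
      dsimp only at h'
      rwa [join_parts, ← hy, join_parts] at h'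
    · intro h b
      have h' := h (join τ (cvxPart τ x) b) (cvxPart_join _ _ _)
      rw [ccvPart_join] at h'
      simpa only [join_parts] using h'
  have hmem : v ∈ pdSubgradient τ f x ↔
      -cvxPart τ v ∈ cvxSubdifferential τ f x ∧ ccvPart τ v ∈ ccvSuperdifferential τ f x := by
    constructor
    · rintro ⟨p, hp, q, hq, rfl⟩
      rw [cvxPart_join, ccvPart_join, neg_neg]
      exact ⟨hp, hq⟩
    · rintro ⟨hp, hq⟩
      exact ⟨_, hp, _, hq, by rw [neg_neg, join_parts]⟩
  rw [hmem, hcvx, hccv]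
  have hpair (y : N → ℝ) : ∑ᶠ i, v i * (y i - x i) =
      ∑ᶠ i, cvxPart τ v i * (cvxPart τ y i - cvxPart τ x i) +
        ∑ᶠ i, ccvPart τ v i * (ccvPart τ y i - ccvPart τ x i) :=
    finsum_mul_eq_add_blocks τ v fun i => y i - x i
  -- Test vectors agree with `x` on one block, so that block drops out of the pairing.
  refine and_congr (forall₂_congr fun y hy => ?_) (forall₂_congr fun y hy => ?_)
  · rw [hpair, hy]
    simp only [Pi.neg_apply, neg_mul, finsum_neg_distrib, sub_self, mul_zero, finsum_zero,
      add_zero]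
  · rw [hpair, hy]
    simp only [sub_self, mul_zero, finsum_zero, zero_add]

theorem finsum_sum_type [Finite M] (a : N ⊕ M → ℝ) :
    ∑ᶠ i, a i = ∑ᶠ i, a (Sum.inl i) + ∑ᶠ j, a (Sum.inr j) := by
  have := Fintype.ofFinite N
  have := Fintype.ofFinite M
  simp only [finsum_eq_sum_of_fintype, Fintype.sum_sum_type]

/-- This turns the Minkowski sum in `nddProd` into a Cartesian product of sets of directions. -/
theorem push_inl_add_push_inr [Finite M] (v : N → ℝ) (w : M → ℝ) :
    push Sum.inl v + push Sum.inr w = Sum.elim v w := by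
  refine eq_of_finsum_mul_eq fun y => ?_
  have := Fintype.ofFinite N
  have := Fintype.ofFinite M
  have h₁ := finsum_push_mul (Sum.inl : N → N ⊕ M) v y
  have h₂ := finsum_push_mul (Sum.inr : M → N ⊕ M) w y
  rw [finsum_sum_type fun i => Sum.elim v w i * y i]
  simp only [Sum.elim_inl, Sum.elim_inr, ← h₁, ← h₂, Pi.add_apply, add_mul]
  exact finsum_add_distrib (Set.toFinite _) (Set.toFinite _)

/-- The primal-dual subgradient system of a separable sum is the Minkowski sum of the primal-dual
subgradient systems of the summands. -/
theorem pdSubgradient_separable_add [Finite M] (f : (N → ℝ) → ℝ) (g : (M → ℝ) → ℝ) :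
    pdSubgradient (Sum.elim τ σ) (fun z => f (pull Sum.inl z) + g (pull Sum.inr z)) =
      nddProd (pdSubgradient τ f) (pdSubgradient σ g) := by
  funext z
  obtain ⟨x, y, rfl⟩ : ∃ x y, z = Sum.elim x y := ⟨_, _, (Sum.elim_comp_inl_inr z).symm⟩
  have hmem (v : N ⊕ M → ℝ) :
      v ∈ nddProd (pdSubgradient τ f) (pdSubgradient σ g) (Sum.elim x y) ↔
        pull Sum.inl v ∈ pdSubgradient τ f x ∧ pull Sum.inr v ∈ pdSubgradient σ g y := by
    constructor
    · rintro ⟨_, ⟨a, ha, rfl⟩, _, ⟨b, hb, rfl⟩, rfl⟩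
      simp only [push_inl_add_push_inr]
      exact ⟨ha, hb⟩
    · rintro ⟨ha, hb⟩
      exact ⟨_, ⟨_, ha, rfl⟩, _, ⟨_, hb, rfl⟩,
        (push_inl_add_push_inr _ _).trans (Sum.elim_comp_inl_inr v)⟩
  have hcvx (a : N → ℝ) (b : M → ℝ) :
      cvxPart (Sum.elim τ σ) (Sum.elim a b) = cvxPart (Sum.elim τ σ) (Sum.elim x y) ↔
        cvxPart τ a = cvxPart τ x ∧ cvxPart σ b = cvxPart σ y := by
    simp [funext_iff, cvxPart]
  have hccv (a : N → ℝ) (b : M → ℝ) :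
      ccvPart (Sum.elim τ σ) (Sum.elim a b) = ccvPart (Sum.elim τ σ) (Sum.elim x y) ↔
        ccvPart τ a = ccvPart τ x ∧ ccvPart σ b = ccvPart σ y := by
    simp [funext_iff, ccvPart]
  have hpull₁ (a : N → ℝ) (b : M → ℝ) : pull Sum.inl (Sum.elim a b) = a := rfl
  have hpull₂ (a : N → ℝ) (b : M → ℝ) : pull Sum.inr (Sum.elim a b) = b := rfl
  ext v
  rw [hmem, mem_pdSubgradient_iff, mem_pdSubgradient_iff, mem_pdSubgradient_iff]
  have hpair (a : N → ℝ) (b : M → ℝ) :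
      ∑ᶠ i, v i * (Sum.elim a b i - Sum.elim x y i) =
        ∑ᶠ i, pull Sum.inl v i * (a i - x i) + ∑ᶠ j, pull Sum.inr v j * (b j - y j) :=
    finsum_sum_type _
  constructor
  · rintro ⟨h₁, h₂⟩
    -- Test vectors move in one summand only; the increment and the pairing of the other summand
    -- vanish.
    refine ⟨⟨fun a ha => ?_, fun a ha => ?_⟩, fun b hb => ?_, fun b hb => ?_⟩
    · simpa [hpair, hpull₁, hpull₂, -pull_apply] using h₁ (Sum.elim a y) ((hccv _ _).2 ⟨ha, rfl⟩)
    · simpa [hpair, hpull₁, hpull₂, -pull_apply] using h₂ (Sum.elim a y) ((hcvx _ _).2 ⟨ha, rfl⟩)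
    · simpa [hpair, hpull₁, hpull₂, -pull_apply] using h₁ (Sum.elim x b) ((hccv _ _).2 ⟨rfl, hb⟩)
    · simpa [hpair, hpull₁, hpull₂, -pull_apply] using h₂ (Sum.elim x b) ((hcvx _ _).2 ⟨rfl, hb⟩)
  · rintro ⟨⟨h₁, h₂⟩, h₃, h₄⟩
    constructor
    · intro c
      obtain ⟨a, b, rfl⟩ : ∃ a b, c = Sum.elim a b := ⟨_, _, (Sum.elim_comp_inl_inr c).symm⟩
      intro hc
      obtain ⟨ha, hb⟩ := (hccv a b).1 hc
      simp only [hpair, hpull₁, hpull₂]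
      linarith [h₁ a ha, h₃ b hb]
    · intro c
      obtain ⟨a, b, rfl⟩ : ∃ a b, c = Sum.elim a b := ⟨_, _, (Sum.elim_comp_inl_inr c).symm⟩
      intro hc
      obtain ⟨ha, hb⟩ := (hcvx a b).1 hc
      simp only [hpair, hpull₁, hpull₂]
      linarith [h₂ a ha, h₄ b hb]

/-- There is only one point and one direction, and every inequality compares `0` with `0`. -/
theorem pdSubgradient_of_isEmpty [IsEmpty N] (f : (N → ℝ) → ℝ) :
    pdSubgradient τ f = fun _ => {0} := by
  funext z
  ext v
  simp only [Subsingleton.elim v 0, Set.mem_singleton_iff, iff_true, mem_pdSubgradient_iff]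
  constructor <;> intro y _ <;> simp [Subsingleton.elim y z]

end Blocks

/-! ### The monoidal natural transformation -/

/-- The primal-dual subgradient transformation. -/
noncomputable def pdSubgradientTransformation : Saddle ⟶ U ⋙ NDD where
  app X := TypeCat.ofHom fun f : SaddleFun X => pdSubgradient (fun i => X.hom i) f.1
  naturality X Y φ := by
    refine ConcreteCategory.hom_ext _ _ fun f => ?_
    exact pdSubgradient_comp_pull f.2 φ.left (label_map φ)

instance : NatTrans.IsMonoidal pdSubgradientTransformation where
  unit := by
    refine ConcreteCategory.hom_ext _ _ fun f => ?_
    have h := pdSubgradient_of_isEmpty (N := Empty) (τ := Empty.elim) fun _ => 0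
    refine h.trans ?_
    funext z
    -- The unit of `U ⋙ NDD` also applies `NDD` to the unit comparison of `U`, an identity, whence
    -- the pushforward along the identity. The product comparison below behaves likewise.
    change {0} = push (fun i : Empty => i) '' {0}
    simp
  tensor X Y := by
    refine ConcreteCategory.hom_ext _ _ fun p => ?_
    refine Eq.trans (b := nddProd (pdSubgradient (fun i => X.hom i) p.1.1)
      (pdSubgradient (fun i => Y.hom i) p.2.1)) ?_ ?_
    · refine Eq.trans ?_ (pdSubgradient_separable_add p.1.1 p.2.1)
      congr 1
    · funext z
      change _ = push (fun i : X.left ⊕ Y.left => i) ''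
        nddProd (pdSubgradient (fun i => X.hom i) p.1.1) (pdSubgradient (fun i => Y.hom i) p.2.1) z
      simp only [push_id, Set.image_id']

end PDSubg

theorem mainTheorem6 :
    ∃ pdsubg : PDSubg.Saddle ⟶ PDSubg.U ⋙ PDSubg.NDD,
      NatTrans.IsMonoidal pdsubg ∧
        ∀ (X : PDSubg.LabelledFinSet) (f : PDSubg.SaddleFun X),
          pdsubg.app X f = PDSubg.pdSubgradient (fun i => X.hom i) f.1 :=
  ⟨PDSubg.pdSubgradientTransformation, inferInstance, fun _ _ => rfl⟩
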